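/- A \emph{surface} is a connected, second countable, Hausdorff space $S$ in which every point has an open neighbourhood homeomorphic to an open subset of the closed half-plane $\{(x,y)\in\mathbb R^2 : y\ge 0\}$ (the boundary may be empty); it is \emph{orientable} if it contains no subspace homeomorphic to a M\"obius band. The \emph{interior} of $S$ is the set of points with an open neighbourhood homeomorphic to an open subset of $\mathbb R^2$. An \emph{exiting sequence} in $S$ is a sequence $U_0\supseteq U_1\supseteq\cdots$ of nonempty connected open subsets with compact boundary $\partial U_n$ such that every compact $K\subseteq S$ satisfies $U_N\cap K=\varnothing$ for some $N$. Exiting sequences $(U_n)$ and $(V_n)$ are equivalent if for every $n$ there is $m$ with $U_m\subseteq V_n$ and $V_m\subseteq U_n$. The \emph{end space} $\mathcal E$ of $S$ is the set of equivalence classes, topologized by taking as a basis the sets $\widehat V=\{[(U_n)] : U_n\subseteq V \text{ for some } n\}$, for $V\subseteq S$ open with compact boundary. An end $[(U_n)]$ is \emph{planar} if for some $n$ the intersection of $U_n$ with the interior of $S$ is homeomorphic to an open subset of $\mathbb R^2$ (if $\partial S=\varnothing$, this intersection is $U_n$); $\mathcal E_{np}$ denotes the set of non-planar ends. Subsets $A,B\subseteq\mathcal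 E$ are \emph{homeomorphic as pairs} if there is a homeomorphism $A\to B$ that maps $A\cap\mathcal E_{np}$ onto $B\cap\mathcal E_{np}$. The pair $(\mathcal E,\mathcal E_{np})$ is \emph{self-similar} if $\mathcal E\neq\varnothing$ and, whenever $\mathcal E=P_1\sqcup\cdots\sqcup P_n$ with $P_1,\dots,P_n$ pairwise disjoint and clopen, there are $i$ and an open set $A\subseteq P_i$ that is homeomorphic to $\mathcal E$ as a pair. It has \emph{radial symmetry} if either $\mathcal E$ is a single point, or there are a point $x\in\mathcal E$ and non-compact open subsets $E_n\subseteq\mathcal E$ $(n\in\mathbb N)$, pairwise homeomorphic as pairs, such that $\overline{E_n}\cap E_m=\varnothing$ for $n\ne m$ and $\mathcal E\smallsetminus\{x\}=\bigsqcup_{n\in\mathbb N}E_n$. \textbf{Theorem.} Let $S$ be an orientable surface with end space $\mathcal E$ and set of non-planar ends $\mathcal E_{np}$. Then $(\mathcal E,\mathcal E_{np})$ is self-similar if and only if it has radial symmetry. -/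

import Mathlib

open Set Topology

/-! Surfaces -/

/-- A (topological) surface: a connected, second countable, Hausdorff space in which every point
has an open neighbourhood homeomorphic to an open subset of the closed upper half-plane.
The boundary may be empty, in which case the surface is a 2-manifold. -/
structure IsTopologicalSurface (S : Type*) [TopologicalSpace S] : Prop where
  connected : ConnectedSpace S
  secondCountable : SecondCountableTopology S
  hausdorff : T2Space S
  locally_half_plane : ∀ p : S, ∃ U : Set S, IsOpen U ∧ p ∈ U ∧
    ∃ O : Set (ℝ × ℝ), IsOpen O ∧ Nonempty (U ≃ₜ ↥(O ∩ {v : ℝ × ℝ | 0 ≤ v.2}))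

/-- The manifold interior of a surface: the points with an open neighbourhood homeomorphic to an
open subset of the plane. It is the whole space for a surface without boundary. -/
def manifoldInterior (S : Type*) [TopologicalSpace S] : Set S :=
  {p | ∃ U : Set S, IsOpen U ∧ p ∈ U ∧ ∃ O : Set (ℝ × ℝ), IsOpen O ∧ Nonempty (U ≃ₜ O)}

/-- The gluing relation `(0, t) ∼ (1, 1 - t)` on the unit square. -/
def mobiusRel (p q : unitInterval × unitInterval) : Prop :=
  p.1 = 0 ∧ q.1 = 1 ∧ q.2 = unitInterval.symm p.2

/-- The (closed) Möbius band: the quotient of the unit square by the equivalence relation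
generated by the gluing relation, with the quotient topology. -/
abbrev MobiusBand : Type := Quot mobiusRel

/-- A surface is orientable if no subspace of it is homeomorphic to the Möbius band. -/
def IsOrientableSurface (S : Type*) [TopologicalSpace S] : Prop :=
  ¬ ∃ f : MobiusBand → S, IsEmbedding f

/-! Ends -/

/-- An exiting sequence: a decreasing sequence of (nonempty) connected open sets with compact
boundary that eventually leaves every compact set. -/
structure ExitingSequence (X : Type*) [TopologicalSpace X] where
  sets : ℕ → Set X
  isOpen_sets : ∀ n, IsOpen (sets n)
  isConnected_sets : ∀ n, IsConnected (sets n)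
  isCompact_frontier : ∀ n, IsCompact (frontier (sets n))
  subset_succ : ∀ n, sets (n + 1) ⊆ sets n
  exits : ∀ K : Set X, IsCompact K → ∃ N, sets N ∩ K = ∅

theorem ExitingSequence.anti {X : Type*} [TopologicalSpace X] (U : ExitingSequence X) :
    Antitone U.sets :=
  antitone_nat_of_succ_le U.subset_succ

/-- Two exiting sequences are equivalent if their terms are mutually cofinal. -/
def exitingSetoid (X : Type*) [TopologicalSpace X] : Setoid (ExitingSequence X) where
  r U V := ∀ n, ∃ m, U.sets m ⊆ V.sets n ∧ V.sets m ⊆ U.sets n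
  iseqv :=
    { refl := fun _ n => ⟨n, subset_rfl, subset_rfl⟩
      symm := fun h n => by
        obtain ⟨m, h1, h2⟩ := h n
        exact ⟨m, h2, h1⟩
      trans := fun {U V W} h k n => by
        obtain ⟨a, ha, _⟩ := k n
        obtain ⟨b, hb, _⟩ := h a
        obtain ⟨c, _, hc⟩ := h n
        obtain ⟨d, _, hd⟩ := k c
        exact ⟨max b d, ((U.anti (le_max_left b d)).trans hb).trans ha,
          ((W.anti (le_max_right b d)).trans hd).trans hc⟩ }

/-- The set of ends of a space. -/
def EndSpace (X : Type*) [TopologicalSpace X] : Type _ := Quotient (exitingSetoid X)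

/-- The end represented by an exiting sequence. -/
def ExitingSequence.toEnd {X : Type*} [TopologicalSpace X] (U : ExitingSequence X) : EndSpace X :=
  Quotient.mk (exitingSetoid X) U

/-- The set of ends that are eventually contained in `V`. -/
def endsIn {X : Type*} [TopologicalSpace X] (V : Set X) : Set (EndSpace X) :=
  {e | ∃ U : ExitingSequence X, U.toEnd = e ∧ ∃ n, U.sets n ⊆ V}

/-- The topology with basis the sets `endsIn V`, for `V` open with compact boundary. -/
instance (X : Type*) [TopologicalSpace X] : TopologicalSpace (EndSpace X) :=
  TopologicalSpace.generateFrom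
    {W | ∃ V : Set X, IsOpen V ∧ IsCompact (frontier V) ∧ W = endsIn V}

/-- An end is planar if some term of a representing sequence has interior (as a surface; this is
the term itself if there is no boundary) homeomorphic to an open subset of the plane. -/
def IsPlanarEnd {S : Type*} [TopologicalSpace S] (e : EndSpace S) : Prop :=
  ∃ U : ExitingSequence S, U.toEnd = e ∧ ∃ n, ∃ O : Set (ℝ × ℝ), IsOpen O ∧
    Nonempty (↥(U.sets n ∩ manifoldInterior S) ≃ₜ O)

/-- The set of non-planar ends. -/
def nonplanarEnds (S : Type*) [TopologicalSpace S] : Set (EndSpace S) :=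
  {e | ¬ IsPlanarEnd e}

/-! Self-similarity and radial symmetry of a space `E` with a distinguished subset `F` -/

/-- The subsets `A` and `B` of `E`, viewed as the pairs `(A, A ∩ F)` and `(B, B ∩ F)`, are
homeomorphic as pairs. -/
def PairHomeomorphic {E : Type*} [TopologicalSpace E] (F A B : Set E) : Prop :=
  ∃ f : A ≃ₜ B, ∀ a : A, (f a : E) ∈ F ↔ (a : E) ∈ F

/-- Self-similarity of the pair `(E, F)`: in each finite partition of `E` into clopen subsets, some
piece contains an open subset homeomorphic to `E` as a pair. (For `n = 0` this says that `E` is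
nonempty.) -/
def IsSelfSimilar (E : Type*) [TopologicalSpace E] (F : Set E) : Prop :=
  ∀ (n : ℕ) (P : Fin n → Set E), (∀ i, IsClopen (P i)) → Pairwise (fun i j => Disjoint (P i) (P j)) →
    (⋃ i, P i) = univ → ∃ i, ∃ A ⊆ P i, IsOpen A ∧ PairHomeomorphic F A univ

/-- `x` is a star point of the pair `(E, F)`: the complement of `x` is the topological disjoint
union of a sequence of pairwise homeomorphic (as pairs) non-compact subsets. -/
def IsStarPoint {E : Type*} [TopologicalSpace E] (F : Set E) (x : E) : Prop :=
  ∃ D : ℕ → Set E, (∀ n, IsOpen (D n)) ∧ (∀ n, ¬ IsCompact (D n)) ∧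
    (∀ n m, PairHomeomorphic F (D n) (D m)) ∧
    (∀ n m, n ≠ m → Disjoint (closure (D n)) (D m)) ∧ (⋃ n, D n) = {x}ᶜ

/-- Radial symmetry of the pair `(E, F)`. -/
def HasRadialSymmetry (E : Type*) [TopologicalSpace E] (F : Set E) : Prop :=
  (∃ x : E, (univ : Set E) = {x}) ∨ ∃ x : E, IsStarPoint F x

/-! Pair homeomorphisms -/

section Pair

variable {E : Type*} [TopologicalSpace E] {F : Set E}

/-! The surface enters only through its end space, which is compact, totally separated and second
countable (`compactSpace_endSpace`, `secondCountableTopology_endSpace`). The equivalence then holds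
for any such space `E` and an arbitrary subset `F`.

Radial symmetry gives self-similarity by a Hilbert hotel argument. A closed set missing the star
point `x` is compact, hence meets only finitely many of the sets `D n`, so these converge to `x`. If
`P` is the piece containing `x`, then `Pᶜ` lies in a finite block of the `D n`. Each later block
contains a copy of `Pᶜ`, and shifting every copy to the next one identifies `E` with `P`
(`pairHomeomorphic_compl_of_tendsto`).

Conversely, compactness yields a point `x` all of whose clopen neighbourhoods contain copies of `E`.
Cut `E \ {x}` into clopen differences `A m` of a neighbourhood basis of `x`, and place disjoint
copies of each `A m`, infinitely many, shrinking towards `x` (`exists_disjoint_copies`). Split each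
`A m` into the part met by these copies and the rest `B m`, and split the copies accordingly. Then
`E \ {x}` is a disjoint union of countably many types of open piece, each occurring infinitely
often. Dealing the occurrences out along a bijection `ℕ ≃ ℕ × ℕ` produces infinitely many
homeomorphic sets, each containing infinitely many pieces of every type. -/

theorem PairHomeomorphic.refl (A : Set E) : PairHomeomorphic F A A :=
  ⟨Homeomorph.refl _, fun _ => Iff.rfl⟩

theorem PairHomeomorphic.symm {A B : Set E} (h : PairHomeomorphic F A B) :
    PairHomeomorphic F B A := by
  obtain ⟨f, hf⟩ := h
  refine ⟨f.symm, fun b => ?_⟩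
  have := hf (f.symm b)
  rw [f.apply_symm_apply] at this
  exact this.symm

theorem PairHomeomorphic.trans {A B C : Set E} (h : PairHomeomorphic F A B)
    (k : PairHomeomorphic F B C) : PairHomeomorphic F A C := by
  obtain ⟨f, hf⟩ := h
  obtain ⟨g, hg⟩ := k
  exact ⟨f.trans g, fun a => (hg (f a)).trans (hf a)⟩

/-- Two embeddings of the same space that agree about membership in `F` have homeomorphic ranges. -/
theorem pairHomeomorphic_range {Z : Type*} [TopologicalSpace Z] {φ ψ : Z → E}
    (hφ : IsEmbedding φ) (hψ : IsEmbedding ψ) (h : ∀ z, ψ z ∈ F ↔ φ z ∈ F) :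
    PairHomeomorphic F (range φ) (range ψ) := by
  refine ⟨hφ.toHomeomorph.symm.trans hψ.toHomeomorph, ?_⟩
  rintro ⟨_, z, rfl⟩
  have : hφ.toHomeomorph.symm ⟨φ z, mem_range_self z⟩ = z :=
    hφ.toHomeomorph.symm_apply_eq.2 (Subtype.ext rfl)
  simp only [Homeomorph.trans_apply, this]
  exact h z

/-- Open embeddings with disjoint ranges glue to an open embedding of the disjoint union. -/
theorem isOpenEmbedding_sigma_of_disjoint {X ι : Type*} {Y : ι → Type*} [TopologicalSpace X]
    [∀ i, TopologicalSpace (Y i)] {f : ∀ i, Y i → X} (hf : ∀ i, IsOpenEmbedding (f i))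
    (hd : Pairwise fun i j => Disjoint (range (f i)) (range (f j))) :
    IsOpenEmbedding fun p : Σ i, Y i => f p.1 p.2 := by
  refine .of_continuous_injective_isOpenMap
    (continuous_sigma fun i => (hf i).continuous) ?_ (isOpenMap_sigma.2 fun i => (hf i).isOpenMap)
  rintro ⟨i, a⟩ ⟨j, b⟩ hab
  obtain rfl : i = j := by
    by_contra hij
    exact (hd hij).le_bot ⟨⟨a, rfl⟩, ⟨b, hab.symm⟩⟩
  exact congrArg _ ((hf i).injective hab)

theorem range_sigma_uncurry {X ι : Type*} {Y : ι → Type*} (f : ∀ i, Y i → X) :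
    (range fun p : Σ i, Y i => f p.1 p.2) = ⋃ i, range (f i) := by
  ext x
  simp

/-- Pair homeomorphisms between the members of two families of disjoint open sets glue. -/
theorem PairHomeomorphic.iUnion {ι : Type*} {A B : ι → Set E} (hA : ∀ i, IsOpen (A i))
    (hB : ∀ i, IsOpen (B i)) (hAd : Pairwise fun i j => Disjoint (A i) (A j))
    (hBd : Pairwise fun i j => Disjoint (B i) (B j)) (h : ∀ i, PairHomeomorphic F (A i) (B i)) :
    PairHomeomorphic F (⋃ i, A i) (⋃ i, B i) := by
  choose f hf using h
  have hr : ∀ i, range (fun a : A i => (f i a : E)) = B i := fun i => by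
    rw [show (fun a : A i => (f i a : E)) = Subtype.val ∘ f i from rfl, range_comp,
      (f i).surjective.range_eq, image_univ, Subtype.range_coe]
  have h1 := isOpenEmbedding_sigma_of_disjoint (f := fun i (a : A i) => (a : E))
    (fun i => (hA i).isOpenEmbedding_subtypeVal) (by simpa using hAd)
  have h2 := isOpenEmbedding_sigma_of_disjoint (f := fun i (a : A i) => (f i a : E))
    (fun i => (hB i).isOpenEmbedding_subtypeVal.comp (f i).isOpenEmbedding)
    (by simpa [hr] using hBd)
  have := pairHomeomorphic_range (F := F) h1.isEmbedding h2.isEmbedding (fun z => hf z.1 z.2)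
  rw [range_sigma_uncurry fun i (a : A i) => (a : E),
    range_sigma_uncurry fun i (a : A i) => (f i a : E)] at this
  simpa [hr] using this

/-- A pair homeomorphism restricts to open subsets. -/
theorem PairHomeomorphic.exists_restrict {A B K : Set E} (h : PairHomeomorphic F A B)
    (hB : IsOpen B) (hK : IsOpen K) (hKA : K ⊆ A) :
    ∃ L ⊆ B, IsOpen L ∧ PairHomeomorphic F K L := by
  obtain ⟨f, hf⟩ := h
  have h2 : IsEmbedding fun k : K => (f (inclusion hKA k) : E) :=
    IsEmbedding.subtypeVal.comp (f.isEmbedding.comp (IsEmbedding.inclusion hKA))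
  refine ⟨range fun k : K => (f (inclusion hKA k) : E), ?_, ?_, ?_⟩
  · rintro _ ⟨k, rfl⟩
    exact (f _).2
  · exact (hB.isOpenEmbedding_subtypeVal.comp (f.isOpenEmbedding.comp
      (.inclusion hKA (hK.preimage continuous_subtype_val)))).isOpen_range
  · simpa using pairHomeomorphic_range (F := F) IsEmbedding.subtypeVal h2
      (fun k => hf (inclusion hKA k))

theorem PairHomeomorphic.isCompact {A B : Set E} (h : PairHomeomorphic F A B) (hA : IsCompact A) :
    IsCompact B := by
  obtain ⟨f, -⟩ := h
  rw [isCompact_iff_compactSpace] at hA ⊢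
  exact f.compactSpace

end Pair

/-! Radial symmetry implies self-similarity -/

section Radial

variable {E : Type*} [TopologicalSpace E] {F : Set E}

/-- If the clopen sets `K 0, K 1, …` are disjoint, pairwise homeomorphic and converge to a point,
then shifting each of them to its successor identifies the space with the complement of `K 0`. -/
theorem pairHomeomorphic_compl_of_tendsto [CompactSpace E] [T2Space E] {x : E} {K : ℕ → Set E}
    (hK : ∀ t, IsClopen (K t)) (hd : Pairwise fun s t => Disjoint (K s) (K t))
    (hx : ∀ t, x ∉ K t) (hlim : ∀ V, IsOpen V → x ∈ V → ∃ T, ∀ t ≥ T, K t ⊆ V)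
    (h : ∀ t, PairHomeomorphic F (K t) (K (t + 1))) : PairHomeomorphic F (K 0)ᶜ univ := by
  classical
  choose θ hθ using h
  let G : E → E := fun y => if hy : ∃ t, y ∈ K t then θ hy.choose ⟨y, hy.choose_spec⟩ else y
  have hG : ∀ t (y : K t), G y = θ t y := by
    intro t y
    have hy : ∃ s, (y : E) ∈ K s := ⟨t, y.2⟩
    have key : ∀ s (hs : (y : E) ∈ K s), (θ s ⟨y, hs⟩ : E) = θ t y := by
      intro s hs
      obtain rfl : s = t := by
        by_contra hst
        exact (hd hst).le_bot ⟨hs, y.2⟩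
      rfl
    simp only [G, dif_pos hy]
    exact key _ _
  have hG' : ∀ y, (∀ t, y ∉ K t) → G y = y := fun y hy => dif_neg (not_exists.2 hy)
  have hGK : ∀ t y, y ∈ K t → G y ∈ K (t + 1) := fun t y hy => by
    rw [hG t ⟨y, hy⟩]
    exact (θ t ⟨y, hy⟩).2
  have hGF : ∀ y, G y ∈ F ↔ y ∈ F := by
    intro y
    by_cases hy : ∃ t, y ∈ K t
    · obtain ⟨t, ht⟩ := hy
      rw [hG t ⟨y, ht⟩]
      exact hθ t ⟨y, ht⟩
    · rw [hG' y (not_exists.1 hy)]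
  have hfin : ∀ T, IsOpen (⋃ t ∈ Finset.range T, K t)ᶜ := fun T =>
    ((Finset.range T).finite_toSet.isClosed_biUnion fun t _ => (hK t).1).isOpen_compl
  have hcont : Continuous G := by
    refine continuous_iff_continuousAt.2 fun y => ?_
    by_cases hy : ∃ t, y ∈ K t
    · obtain ⟨t, ht⟩ := hy
      have : ContinuousOn G (K t) := by
        rw [continuousOn_iff_continuous_domRestrict]
        exact (continuous_subtype_val.comp (θ t).continuous).congr fun z => (hG t z).symm
      exact this.continuousAt ((hK t).2.mem_nhds ht)
    have hy := not_exists.1 hy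
    have hyT : ∀ T, y ∈ (⋃ t ∈ Finset.range T, K t)ᶜ := fun T => by simpa using fun t _ => hy t
    -- At `x`, discarding the first `T` sets leaves only points that are fixed or moved into some `K
    -- (t + 1)` inside `V`. Away from `x`, the late sets are near `x` and the early ones form a
    -- closed set missing `y`, so `G` is the identity near `y`.
    by_cases hyx : y = x
    · subst hyx
      rw [ContinuousAt, hG' y hy]
      refine (nhds_basis_opens y).tendsto_right_iff.2 fun V ⟨hyV, hV⟩ => ?_
      obtain ⟨T, hT⟩ := hlim V hV hyV
      filter_upwards [(hV.inter (hfin T)).mem_nhds ⟨hyV, hyT T⟩] with z hz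
      by_cases hzK : ∃ t, z ∈ K t
      · obtain ⟨t, ht⟩ := hzK
        have hTt : T ≤ t := by
          by_contra! hlt
          exact hz.2 (mem_iUnion₂.2 ⟨t, Finset.mem_range.2 hlt, ht⟩)
        exact hT (t + 1) (by omega) (hGK t z ht)
      · rw [hG' z (not_exists.1 hzK)]
        exact hz.1
    · obtain ⟨W, V, hW, hV, hyW, hxV, hWV⟩ := t2_separation hyx
      obtain ⟨T, hT⟩ := hlim V hV hxV
      refine continuousAt_id.congr ?_
      filter_upwards [(hW.inter (hfin T)).mem_nhds ⟨hyW, hyT T⟩] with z hz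
      refine (hG' z fun t ht => ?_).symm
      rcases lt_or_ge t T with hlt | hge
      · exact hz.2 (mem_iUnion₂.2 ⟨t, Finset.mem_range.2 hlt, ht⟩)
      · exact hWV.le_bot ⟨hz.1, hT t hge ht⟩
  have hinj : Function.Injective G := by
    intro y z hyz
    by_cases hy : ∃ t, y ∈ K t <;> by_cases hz : ∃ t, z ∈ K t
    · obtain ⟨t, ht⟩ := hy
      obtain ⟨s, hs⟩ := hz
      obtain rfl : t = s := by
        by_contra hts
        exact (hd fun h : t + 1 = s + 1 => hts (by omega)).le_bot
          ⟨hGK t y ht, hyz ▸ hGK s z hs⟩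
      rw [hG t ⟨y, ht⟩, hG t ⟨z, hs⟩] at hyz
      simpa using (θ t).injective (Subtype.ext hyz)
    · obtain ⟨t, ht⟩ := hy
      rw [hG' z (not_exists.1 hz)] at hyz
      exact absurd ⟨t + 1, hyz ▸ hGK t y ht⟩ hz
    · obtain ⟨t, ht⟩ := hz
      rw [hG' y (not_exists.1 hy)] at hyz
      exact absurd ⟨t + 1, hyz ▸ hGK t z ht⟩ hy
    · rwa [hG' y (not_exists.1 hy), hG' z (not_exists.1 hz)] at hyz
  have hrange : range G = (K 0)ᶜ := by
    ext y
    constructor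
    · rintro ⟨z, rfl⟩ h0
      by_cases hz : ∃ t, z ∈ K t
      · obtain ⟨t, ht⟩ := hz
        exact (hd (Nat.succ_ne_zero t)).le_bot ⟨hGK t z ht, h0⟩
      · rw [hG' z (not_exists.1 hz)] at h0
        exact hz ⟨0, h0⟩
    · intro hy
      by_cases hy' : ∃ t, y ∈ K t
      · obtain ⟨_ | t, ht⟩ := hy'
        · exact absurd ht hy
        · refine ⟨(θ t).symm ⟨y, ht⟩, ?_⟩
          rw [hG, Homeomorph.apply_symm_apply]
      · exact ⟨y, hG' y (not_exists.1 hy')⟩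
  have := pairHomeomorphic_range (F := F) (hcont.isClosedEmbedding hinj).isEmbedding
    IsEmbedding.id fun y => (hGF y).symm
  rwa [hrange, range_id] at this

theorem IsStarPoint.isSelfSimilar [CompactSpace E] [T2Space E] {x : E} (h : IsStarPoint F x) :
    IsSelfSimilar E F := by
  obtain ⟨D, hD, -, hDD, hdis, hun⟩ := h
  have hdis' : Pairwise fun m n => Disjoint (D m) (D n) := fun m n hmn =>
    (hdis m n hmn).mono_left subset_closure
  -- The sets `D n` converge to `x`: a closed set missing `x` is compact and covered by them.
  have hbound : ∀ L : Set E, IsClosed L → x ∉ L → ∃ N, ∀ n ≥ N, Disjoint (D n) L := by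
    intro L hL hxL
    obtain ⟨t, ht⟩ := hL.isCompact.elim_finite_subcover D hD
      (by rw [hun]; exact subset_compl_singleton_iff.2 hxL)
    refine ⟨t.sup id + 1, fun n hn => disjoint_left.2 fun y hy hyL => ?_⟩
    obtain ⟨m, hm, hym⟩ := mem_iUnion₂.1 (ht hyL)
    have : m ≤ t.sup id := Finset.le_sup (f := id) hm
    exact (hdis' (by omega : n ≠ m)).le_bot ⟨hy, hym⟩
  intro n P hP hPd hPu
  obtain ⟨i, hi⟩ := mem_iUnion.1 (hPu ▸ mem_univ x)
  refine ⟨i, P i, subset_rfl, (hP i).2, ?_⟩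
  obtain ⟨N, hN⟩ := hbound (P i)ᶜ (hP i).2.isClosed_compl (not_not.2 hi)
  -- Blocks of `N` consecutive sets, with `N` so large that the block `B 0` contains `(P i)ᶜ`.
  let B : ℕ → Set E := fun t => ⋃ r : Fin N, D (t * N + r)
  have hBo : ∀ t, IsOpen (B t) := fun t => isOpen_iUnion fun r => hD _
  have hBx : ∀ t, x ∉ B t := fun t hx => by
    have : x ∈ ⋃ n, D n := by
      obtain ⟨r, hr⟩ := mem_iUnion.1 hx
      exact mem_iUnion.2 ⟨_, hr⟩
    rw [hun] at this
    exact this rfl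
  have hidx : ∀ {s t : ℕ} {r q : Fin N}, s * N + r = t * N + q → s = t ∧ r = q := by
    intro s t r q h
    have hNpos : 0 < N := r.pos
    have h1 : s = t := by
      have := congrArg (· / N) h
      simpa [Nat.add_div_of_dvd_right, Nat.div_eq_of_lt, hNpos] using this
    subst h1
    exact ⟨rfl, Fin.ext (by omega)⟩
  have hBd : Pairwise fun s t => Disjoint (B s) (B t) := fun s t hst => by
    refine disjoint_iUnion_left.2 fun r => disjoint_iUnion_right.2 fun q => hdis' fun h => ?_
    exact hst (hidx h).1
  have hBB : ∀ t, PairHomeomorphic F (B 0) (B t) := fun t =>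
    PairHomeomorphic.iUnion (fun r => hD _) (fun r => hD _)
      (fun r q hrq => hdis' fun h => hrq (hidx h).2) (fun r q hrq => hdis' fun h => hrq (hidx h).2)
      fun r => hDD _ _
  have hK0 : (P i)ᶜ ⊆ B 0 := by
    intro y hy
    have hyx : y ∈ ⋃ n, D n := by
      rw [hun]
      rintro rfl
      exact hy hi
    obtain ⟨m, hm⟩ := mem_iUnion.1 hyx
    have hmN : m < N := by
      by_contra! hge
      exact (hN m hge).le_bot ⟨hm, hy⟩
    exact mem_iUnion.2 ⟨⟨m, hmN⟩, by simpa using hm⟩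
  have hex : ∀ t, ∃ L ⊆ B t, IsOpen L ∧ PairHomeomorphic F (P i)ᶜ L := fun t =>
    (hBB t).exists_restrict (hBo t) (hP i).compl.2 hK0
  choose L hLB hLo hLh using hex
  -- The zeroth term is `(P i)ᶜ` itself rather than the copy `L 0`, so that `(K 0)ᶜ` is exactly `P
  -- i`.
  let K : ℕ → Set E := fun t => Nat.casesOn t (P i)ᶜ fun t => L (t + 1)
  have hKB : ∀ t, K t ⊆ B t := fun t => by
    cases t with
    | zero => exact hK0
    | succ t => exact hLB _
  have hKK : ∀ t, PairHomeomorphic F (P i)ᶜ (K t) := fun t => by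
    cases t with
    | zero => exact .refl _
    | succ t => exact hLh _
  have hKo : ∀ t, IsOpen (K t) := fun t => by
    cases t with
    | zero => exact (hP i).compl.2
    | succ t => exact hLo _
  have := pairHomeomorphic_compl_of_tendsto (F := F) (x := x) (K := K)
    (fun t => ⟨((hKK t).isCompact (hP i).compl.1.isCompact).isClosed, hKo t⟩)
    (fun s t hst => (hBd hst).mono (hKB s) (hKB t)) (fun t hx => hBx t (hKB t hx)) ?_
    (fun t => (hKK t).symm.trans (hKK (t + 1)))
  · simpa [K] using this
  · intro V hV hxV
    obtain ⟨T, hT⟩ := hbound Vᶜ hV.isClosed_compl (not_not.2 hxV)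
    refine ⟨T, fun t ht y hy => ?_⟩
    obtain ⟨r, hr⟩ := mem_iUnion.1 (hKB t hy)
    have hge : T ≤ t * N + r := by
      have := Nat.le_mul_of_pos_right t r.pos
      omega
    by_contra hyV
    exact (hT _ hge).le_bot ⟨hr, hyV⟩

theorem HasRadialSymmetry.isSelfSimilar [CompactSpace E] [T2Space E]
    (h : HasRadialSymmetry E F) : IsSelfSimilar E F := by
  obtain ⟨x, hx⟩ | ⟨x, hx⟩ := h
  · intro n P hP _ hPu
    obtain ⟨i, hi⟩ := mem_iUnion.1 (hPu ▸ mem_univ x)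
    have : P i = univ := eq_univ_of_univ_subset (by rw [hx]; exact singleton_subset_iff.2 hi)
    exact ⟨i, univ, this.ge, isOpen_univ, .refl _⟩
  · exact hx.isSelfSimilar

end Radial

/-! Self-similarity implies radial symmetry -/

section SelfSimilar

variable {E : Type*} [TopologicalSpace E] {F : Set E}

/-- In a self-similar pair, some point has arbitrarily small clopen neighbourhoods containing open
copies of the whole pair. -/
theorem IsSelfSimilar.exists_point [CompactSpace E] (h : IsSelfSimilar E F) :
    ∃ x : E, ∀ U, IsClopen U → x ∈ U → ∃ A ⊆ U, IsOpen A ∧ PairHomeomorphic F A univ := by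
  -- Otherwise finitely many clopen sets without copies of `E` cover `E`; removing from each its
  -- predecessors gives a partition that contradicts self-similarity.
  by_contra! hc
  choose U hU hxU hA using hc
  obtain ⟨t, ht⟩ := isCompact_univ.elim_finite_subcover U (fun x => (hU x).2)
    fun x _ => mem_iUnion.2 ⟨x, hxU x⟩
  let e := t.equivFin.symm
  let V : Fin t.card → Set E := fun i => U (e i)
  suffices hP : _ ∧ _ ∧ _ by
    obtain ⟨i, A, hAi, hAo, hAu⟩ :=
      h t.card (fun i => V i \ ⋃ j ∈ Iio i, V j) hP.1 hP.2.1 hP.2.2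
    exact hA (e i) A (hAi.trans sdiff_subset) hAo hAu
  refine ⟨fun i => ?_, fun i j hij => ?_, ?_⟩
  · exact (hU _).diff ((toFinite _).isClopen_biUnion fun j _ => hU _)
  · wlog hlt : i < j generalizing i j
    · exact (this j i hij.symm (lt_of_le_of_ne (not_lt.1 hlt) hij.symm)).symm
    · exact disjoint_left.2 fun y hy hy' => hy'.2 (mem_iUnion₂.2 ⟨i, hlt, hy.1⟩)
  · refine eq_univ_of_forall fun y => ?_
    obtain ⟨z, hz, hyz⟩ := mem_iUnion₂.1 (ht (mem_univ y))
    have hne : ∃ i, y ∈ V i := ⟨e.symm ⟨z, hz⟩, by simpa [V] using hyz⟩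
    obtain ⟨i, hi, hmin⟩ := WellFounded.has_min (wellFounded_lt (α := Fin t.card))
      {i | y ∈ V i} hne
    refine mem_iUnion.2 ⟨i, hi, fun hy => ?_⟩
    obtain ⟨j, hj, hyj⟩ := mem_iUnion₂.1 hy
    exact hmin j hyj hj

theorem PairHomeomorphic.exists_isOpenEmbedding {A : Set E} (hA : IsOpen A)
    (h : PairHomeomorphic F A univ) :
    ∃ g : E → E, IsOpenEmbedding g ∧ (∀ y, g y ∈ F ↔ y ∈ F) ∧ ∀ y, g y ∈ A := by
  obtain ⟨f, hf⟩ := h.symm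
  exact ⟨fun y => f ⟨y, mem_univ y⟩, hA.isOpenEmbedding_subtypeVal.comp
    (f.isOpenEmbedding.comp (Homeomorph.Set.univ E).symm.isOpenEmbedding),
    fun y => hf ⟨y, mem_univ y⟩, fun y => (f _).2⟩

/-- Every neighbourhood of the point `x` contains an open copy of the whole space in which no point
other than `x` goes to `x`. -/
theorem exists_isOpenEmbedding_avoiding [CompactSpace E] [T2Space E] [TotallyDisconnectedSpace E]
    {x : E} (hx : ∀ U, IsClopen U → x ∈ U → ∃ A ⊆ U, IsOpen A ∧ PairHomeomorphic F A univ)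
    {V : Set E} (hV : IsOpen V) (hxV : x ∈ V) :
    ∃ g : E → E, IsOpenEmbedding g ∧ (∀ y, g y ∈ F ↔ y ∈ F) ∧ ∀ y ≠ x, g y ∈ V \ {x} := by
  have key : ∀ W : Set E, IsOpen W → x ∈ W →
      ∃ g : E → E, IsOpenEmbedding g ∧ (∀ y, g y ∈ F ↔ y ∈ F) ∧ ∀ y, g y ∈ W := by
    intro W hW hxW
    obtain ⟨U, ⟨hxU, hU⟩, hUW⟩ := (nhds_basis_clopen x).mem_iff.1 (hW.mem_nhds hxW)
    obtain ⟨A, hAU, hA, hAu⟩ := hx U hU hxU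
    obtain ⟨g, hg, hgF, hgA⟩ := hAu.exists_isOpenEmbedding hA
    exact ⟨g, hg, hgF, fun y => hUW (hAU (hgA y))⟩
  obtain ⟨g, hg, hgF, hgV⟩ := key V hV hxV
  -- If `g` fixes `x`, injectivity suffices. If not, `g ⁻¹' {x}ᶜ` is a neighbourhood of `x`, and
  -- precomposing with a copy inside it avoids `x` altogether.
  by_cases hgx : g x = x
  · exact ⟨g, hg, hgF, fun y hy => ⟨hgV y, fun h => hy (hg.injective (h.trans hgx.symm))⟩⟩
  · obtain ⟨k, hk, hkF, hkW⟩ := key (g ⁻¹' {x}ᶜ) (isOpen_compl_singleton.preimage hg.continuous) hgx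
    exact ⟨g ∘ k, hg.comp hk, fun y => (hgF _).trans (hkF y), fun y _ => ⟨hgV _, hkW y⟩⟩

/-- The whole space is prepended to a countable clopen basis at `x`, so that the successive
differences cover everything except `x`. -/
theorem exists_antitone_clopen [CompactSpace E] [T2Space E] [TotallyDisconnectedSpace E]
    [FirstCountableTopology E] (x : E) :
    ∃ U : ℕ → Set E, U 0 = univ ∧ (∀ n, IsClopen (U n)) ∧ (∀ n, x ∈ U n) ∧ Antitone U ∧
      ⋂ n, U n = {x} := by
  obtain ⟨U, hU, hb⟩ := (nhds_basis_clopen x).exists_antitone_subbasis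
  have hanti : Antitone U := hb.antitone
  refine ⟨fun n => Nat.casesOn n univ U, rfl, ?_, ?_, antitone_nat_of_succ_le ?_, ?_⟩
  · rintro (_ | n)
    exacts [isClopen_univ, (hU n).2]
  · rintro (_ | n)
    exacts [mem_univ x, (hU n).1]
  · rintro (_ | n)
    exacts [subset_univ _, hanti n.le_succ]
  · refine subset_antisymm (fun y hy => ?_) ?_
    · by_contra hyx
      obtain ⟨n, hn⟩ := hb.mem_iff.1 (isOpen_compl_singleton.mem_nhds (Ne.symm hyx))
      exact hn (mem_iInter.1 hy (n + 1)) rfl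
    · rintro _ rfl
      refine mem_iInter.2 ?_
      rintro (_ | n)
      exacts [mem_univ _, (hU n).1]

theorem exists_mem_diff_succ {E : Type*} {U : ℕ → Set E} (h0 : U 0 = univ) {y : E}
    (hy : y ∉ ⋂ n, U n) : ∃ m, y ∈ U m \ U (m + 1) := by
  classical
  have hex : ∃ n, y ∉ U n := by simpa using hy
  obtain ⟨m, hm⟩ : ∃ m, Nat.find hex = m + 1 := Nat.exists_eq_succ_of_ne_zero fun h => by
    have := Nat.find_spec hex
    rw [h, h0] at this
    exact this (mem_univ y)
  refine ⟨m, not_not.1 (Nat.find_min hex (by omega)), hm ▸ Nat.find_spec hex⟩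

theorem disjoint_diff_succ {E : Type*} {U : ℕ → Set E} (hU : Antitone U) :
    Pairwise fun m n => Disjoint (U m \ U (m + 1)) (U n \ U (n + 1)) := by
  have key : ∀ m n, m < n → Disjoint (U m \ U (m + 1)) (U n \ U (n + 1)) := fun m n hmn =>
    disjoint_left.2 fun y hy hy' => hy.2 (hU hmn hy'.1)
  intro m n hmn
  rcases lt_or_gt_of_ne hmn with h | h
  exacts [key m n h, (key n m h).symm]

/-- Infinitely many disjoint copies, shrinking towards `x`, of each member of a sequence of clopen
sets not containing `x`. -/
theorem exists_disjoint_copies [CompactSpace E] [T2Space E] [TotallyDisconnectedSpace E]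
    {x : E} (hx : ∀ U, IsClopen U → x ∈ U → ∃ A ⊆ U, IsOpen A ∧ PairHomeomorphic F A univ)
    {U : ℕ → Set E} (hU : ∀ n, IsClopen (U n)) (hxU : ∀ n, x ∈ U n)
    {A : ℕ → Set E} (hA : ∀ n, IsClopen (A n)) (hxA : ∀ n, x ∉ A n) :
    ∃ g : ℕ → E → E, (∀ i, IsOpenEmbedding (g i)) ∧ (∀ i y, g i y ∈ F ↔ y ∈ F) ∧
      (∀ i, g i '' A i ⊆ U i) ∧ (∀ i, x ∉ g i '' A i) ∧
      Pairwise fun i j => Disjoint (g i '' A i) (g j '' A j) := by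
  have key : ∀ V : {V : Set E // IsOpen V ∧ x ∈ V}, ∃ g : E → E, IsOpenEmbedding g ∧
      (∀ y, g y ∈ F ↔ y ∈ F) ∧ ∀ y ≠ x, g y ∈ (V : Set E) \ {x} := fun V =>
    exists_isOpenEmbedding_avoiding hx V.2.1 V.2.2
  choose G hG hGF hGV using key
  have hne : ∀ i, ∀ y ∈ A i, y ≠ x := fun i y hy h => hxA i (h ▸ hy)
  -- Removing the copy just placed leaves an open neighbourhood of `x`: the copy is compact, and it
  -- misses `x` because `x ∉ A i`. The next copy goes there.
  have hstep : ∀ i (V : {V : Set E // IsOpen V ∧ x ∈ V}),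
      IsOpen ((V.1 ∩ U (i + 1)) \ (G V '' A i)) ∧
      x ∈ (V.1 ∩ U (i + 1)) \ (G V '' A i) := by
    intro i V
    refine ⟨(V.2.1.inter (hU _).2).sdiff
      ((hA i).1.isCompact.image (hG V).continuous).isClosed, ⟨V.2.2, hxU _⟩, ?_⟩
    rintro ⟨y, hy, hyx⟩
    exact (hGV V y (hne i y hy)).2 hyx
  let V : ℕ → {V : Set E // IsOpen V ∧ x ∈ V} := fun i =>
    Nat.rec ⟨U 0, (hU 0).2, hxU 0⟩ (fun i V => ⟨(V.1 ∩ U (i + 1)) \ (G V '' A i), hstep i V⟩) i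
  have hVs : ∀ i, (V (i + 1)).1 = ((V i).1 ∩ U (i + 1)) \ (G (V i) '' A i) :=
    fun _ => rfl
  have hVanti : Antitone fun i => (V i).1 := antitone_nat_of_succ_le fun i => by
    rw [hVs]
    exact sdiff_subset.trans inter_subset_left
  have hVU : ∀ i, (V i).1 ⊆ U i := by
    rintro (_ | i)
    · exact subset_rfl
    · rw [hVs]
      exact sdiff_subset.trans inter_subset_right
  have himg : ∀ i, G (V i) '' A i ⊆ (V i).1 \ {x} := by
    rintro i _ ⟨y, hy, rfl⟩
    exact hGV _ y (hne i y hy)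
  refine ⟨fun i => G (V i), fun i => hG _, fun i => hGF _,
    fun i => (himg i).trans (sdiff_subset.trans (hVU i)), fun i h => (himg i h).2 rfl, ?_⟩
  have hlt : ∀ i j, i < j → Disjoint (G (V i) '' A i) (G (V j) '' A j) := by
    intro i j hij
    refine disjoint_left.2 fun y hy hy' => ?_
    have : y ∈ (V (i + 1)).1 := hVanti hij (himg j hy').1
    rw [hVs] at this
    exact this.2 hy
  intro i j hij
  rcases lt_or_gt_of_ne hij with h | h
  exacts [hlt i j h, (hlt j i h).symm]

theorem IsSelfSimilar.hasRadialSymmetry [CompactSpace E] [T2Space E] [TotallyDisconnectedSpace E]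
    [FirstCountableTopology E] (h : IsSelfSimilar E F) : HasRadialSymmetry E F := by
  obtain ⟨x, hx⟩ := h.exists_point
  by_cases huniv : (univ : Set E) = {x}
  · exact .inl ⟨x, huniv⟩
  obtain ⟨U, hU0, hU, hxU, hanti, hUx⟩ := exists_antitone_clopen x
  let A : ℕ → Set E := fun m => U m \ U (m + 1)
  have hA : ∀ m, IsClopen (A m) := fun m => (hU m).diff (hU (m + 1))
  have hxA : ∀ m, x ∉ A m := fun m hm => hm.2 (hxU _)
  have hAd : Pairwise fun m n => Disjoint (A m) (A n) := disjoint_diff_succ hanti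
  have hAx : ∀ y ≠ x, ∃ m, y ∈ A m := fun y hy =>
    exists_mem_diff_succ hU0 (by rw [hUx]; exact hy)
  -- The index `i` codes a pair `(m, k)`, standing for copy number `k` of `A m`.
  obtain ⟨g, hg, hgF, hgU, hxg, hgd⟩ := exists_disjoint_copies hx hU hxU
    (A := fun i => A i.unpair.1) (fun i => hA _) fun i => hxA _
  set D : ℕ → Set E := fun i => g i '' A i.unpair.1 with hD
  have hDc : ∀ i, IsClopen (D i) := fun i =>
    ⟨((hA _).1.isCompact.image (hg i).continuous).isClosed, (hg i).isOpenMap _ (hA _).2⟩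
  let B : ℕ → Set E := fun m => A m \ ⋃ i, D i
  have hB : ∀ m, IsClopen (B m) := by
    intro m
    -- For `i > m` the copy `D i` lies in `U (m + 1)`, which is disjoint from `A m`; so finitely
    -- many copies matter and `B m` is clopen.
    have : B m = A m \ ⋃ i ∈ Iic m, D i := by
      refine subset_antisymm (sdiff_subset_sdiff_right (iUnion₂_subset_iUnion _ _)) ?_
      rintro y ⟨hy, hyD⟩
      refine ⟨hy, fun hyi => ?_⟩
      obtain ⟨i, hi⟩ := mem_iUnion.1 hyi
      rcases le_or_gt i m with hle | hlt
      · exact hyD (mem_iUnion₂.2 ⟨i, hle, hi⟩)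
      · exact hy.2 (hanti hlt (hgU i hi))
    rw [this]
    exact (hA m).diff ((finite_Iic m).isClopen_biUnion fun i _ => hDc i)
  let T : ℕ × Bool → Set E := fun p => bif p.2 then B p.1 else A p.1 \ B p.1
  have hT : ∀ p, IsOpen (T p) := by
    rintro ⟨m, _ | _⟩
    exacts [((hA m).diff (hB m)).2, (hB m).2]
  have hTA : ∀ p, T p ⊆ A p.1 := by
    rintro ⟨m, _ | _⟩
    exacts [sdiff_subset, sdiff_subset]
  -- `φ k p` places occurrence `k` of the piece `T p`. The uncovered part `B m` already occurs once
  -- in place, so its occurrence `0` is the identity and the copies are shifted by one. The covered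
  -- part `A m \ B m` is accounted for inside the copies only.
  let φ : ℕ → ℕ × Bool → E → E := fun k p =>
    bif p.2 then Nat.casesOn k id fun k => g (Nat.pair p.1 k) else g (Nat.pair p.1 k)
  have hφ : ∀ k p, IsOpenEmbedding (φ k p) := by
    rintro (_ | k) ⟨m, _ | _⟩
    exacts [hg _, .id, hg _, hg _]
  have hφF : ∀ k p y, φ k p y ∈ F ↔ y ∈ F := by
    rintro (_ | k) ⟨m, _ | _⟩ y
    exacts [hgF _ y, Iff.rfl, hgF _ y, hgF _ y]
  have hgD : ∀ m k y, y ∈ A m → g (Nat.pair m k) y ∈ D (Nat.pair m k) := fun m k y hy =>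
    ⟨y, by simpa using hy, rfl⟩
  let f : ∀ q : ℕ × ℕ × Bool, T q.2 → E := fun q y => φ q.1 q.2 y
  have hf : ∀ q, IsOpenEmbedding (f q) := fun q =>
    (hφ q.1 q.2).comp (hT q.2).isOpenEmbedding_subtypeVal
  have hinj : ∀ q q' (y : T q.2) (y' : T q'.2), f q y = f q' y' → q = q' := by
    -- Here `j` is the number of the copy used; `b.toNat` records the shift by one for the pieces `B
    -- m`.
    have hcase : ∀ q (y : T q.2), (∃ m, q = (0, m, true) ∧ f q y ∈ B m) ∨
        ∃ k m b j, q = (k, m, b) ∧ k = j + b.toNat ∧ f q y = g (Nat.pair m j) y := by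
      rintro ⟨_ | k, m, _ | _⟩ y
      · exact .inr ⟨_, _, _, 0, rfl, rfl, rfl⟩
      · exact .inl ⟨m, rfl, y.2⟩
      · exact .inr ⟨_, _, _, k + 1, rfl, rfl, rfl⟩
      · exact .inr ⟨_, _, _, k, rfl, rfl, rfl⟩
    have hmem : ∀ m b (y : T (m, b)) j, g (Nat.pair m j) y ∈ ⋃ i, D i := fun m b y j =>
      mem_iUnion.2 ⟨_, hgD m j y (hTA _ y.2)⟩
    intro q q' y y' hyy
    rcases hcase q y with ⟨m, rfl, hm⟩ | ⟨k, m, b, j, rfl, hk, hy⟩ <;>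
      rcases hcase q' y' with ⟨m', rfl, hm'⟩ | ⟨k', m', b', j', rfl, hk', hy'⟩
    · have : m = m' := by
        by_contra hne
        exact (hAd hne).le_bot ⟨hm.1, hyy ▸ hm'.1⟩
      rw [this]
    · exact absurd (hyy ▸ hy' ▸ hmem m' b' y' j') hm.2
    · exact absurd (hyy ▸ hy ▸ hmem m b y j) hm'.2
    · have hpair : Nat.pair m j = Nat.pair m' j' := by
        by_contra hne
        refine (hgd hne).le_bot ⟨hgD m j y (hTA _ y.2), ?_⟩
        rw [← hy, hyy, hy']
        exact hgD m' j' y' (hTA _ y'.2)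
      obtain ⟨rfl, rfl⟩ := Nat.pair_eq_pair.1 hpair
      have hval : (y : E) = y' := (hg _).injective (hy.symm.trans (hyy.trans hy'))
      have hbb : b = b' := by
        have h1 := y.2
        have h2 := y'.2
        rw [hval] at h1
        cases b <;> cases b'
        exacts [rfl, absurd h2 h1.2, absurd h1 h2.2, rfl]
      subst hbb
      rw [hk, hk']
  have hcover : ∀ z, z ≠ x ↔ ∃ q, ∃ y : T q.2, f q y = z := by
    intro z
    constructor
    · intro hz
      by_cases hzD : z ∈ ⋃ i, D i
      · obtain ⟨i, y, hy, rfl⟩ := mem_iUnion.1 hzD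
        by_cases hyB : y ∈ B i.unpair.1
        · refine ⟨(i.unpair.2 + 1, i.unpair.1, true), ⟨y, hyB⟩, ?_⟩
          change g (Nat.pair i.unpair.1 i.unpair.2) y = g i y
          rw [Nat.pair_unpair]
        · refine ⟨(i.unpair.2, i.unpair.1, false), ⟨y, hy, hyB⟩, ?_⟩
          change g (Nat.pair i.unpair.1 i.unpair.2) y = g i y
          rw [Nat.pair_unpair]
      · obtain ⟨m, hm⟩ := hAx z hz
        exact ⟨(0, m, true), ⟨z, hm, hzD⟩, rfl⟩
    · rintro ⟨⟨_ | k, m, _ | _⟩, y, rfl⟩ hyx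
      · exact hxg _ (hyx.subst (motive := (· ∈ D _)) (hgD m 0 y (hTA _ y.2)))
      · exact hxA m (hyx ▸ hTA _ y.2)
      · exact hxg _ (hyx.subst (motive := (· ∈ D _)) (hgD m (k + 1) y (hTA _ y.2)))
      · exact hxg _ (hyx.subst (motive := (· ∈ D _)) (hgD m k y (hTA _ y.2)))
  -- One sector: every piece type, each repeated `ℕ` times. Sector `j` takes the occurrences
  -- numbered `Nat.pair j k`.
  let Z := Σ q : ℕ × ℕ × Bool, T q.2
  let Φ : ℕ → Z → E := fun j z => f (Nat.pair j z.1.1, z.1.2) z.2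
  have hpq : ∀ {j j' : ℕ} {q q' : ℕ × ℕ × Bool},
      (Nat.pair j q.1, q.2) = (Nat.pair j' q'.1, q'.2) → j = j' ∧ q = q' := by
    intro j j' q q' h
    obtain ⟨h1, h2⟩ := Prod.mk.inj h
    obtain ⟨h3, h4⟩ := Nat.pair_eq_pair.1 h1
    exact ⟨h3, Prod.ext h4 h2⟩
  have hΦ : ∀ j, IsOpenEmbedding (Φ j) := fun j =>
    isOpenEmbedding_sigma_of_disjoint (f := fun (q : ℕ × ℕ × Bool) (y : T q.2) =>
      f (Nat.pair j q.1, q.2) y) (fun q => hf (Nat.pair j q.1, q.2)) fun q q' hqq => by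
        refine disjoint_left.2 ?_
        rintro _ ⟨y, rfl⟩ ⟨y', hy'⟩
        exact hqq (hpq (hinj _ _ _ _ hy'.symm)).2
  refine .inr ⟨x, fun j => range (Φ j), fun j => (hΦ j).isOpen_range, fun j hc => ?_,
    fun i j => pairHomeomorphic_range (hΦ i).isEmbedding (hΦ j).isEmbedding
      fun z => (hφF _ _ _).trans (hφF _ _ _).symm, fun i j hij => ?_, ?_⟩
  · obtain ⟨y, hy⟩ : ∃ y, y ≠ x := by
      by_contra! hall
      exact huniv (eq_singleton_iff_unique_mem.2 ⟨mem_univ x, fun y _ => hall y⟩)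
    obtain ⟨q, t, -⟩ := (hcover y).1 hy
    have : CompactSpace Z := by
      rw [← isCompact_univ_iff, (hΦ j).isEmbedding.isCompact_iff, image_univ]
      exact hc
    -- A nonempty piece is repeated for every first index, so a compact `Z` would map continuously
    -- onto the infinite discrete space `ℕ`.
    have hcont : Continuous fun z : Z => z.1.1 :=
      continuous_sigma fun q => continuous_const (y := q.1)
    have hsurj : range (fun z : Z => z.1.1) = univ :=
      eq_univ_of_forall fun l => ⟨⟨(l, q.2), t⟩, rfl⟩
    have := isCompact_range hcont
    rw [hsurj] at this
    exact infinite_univ this.finite_of_discrete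
  · refine Disjoint.closure_left (disjoint_left.2 ?_) (hΦ j).isOpen_range
    rintro _ ⟨z, rfl⟩ ⟨z', hz'⟩
    exact hij (hpq (hinj _ _ _ _ hz'.symm)).1
  · ext z
    rw [mem_compl_singleton_iff, hcover]
    simp only [mem_iUnion, mem_range]
    constructor
    · rintro ⟨j, z', rfl⟩
      exact ⟨_, _, rfl⟩
    · rintro ⟨⟨k, p⟩, y, rfl⟩
      refine ⟨k.unpair.1, ⟨(k.unpair.2, p), y⟩, ?_⟩
      change f (Nat.pair k.unpair.1 k.unpair.2, p) y = f (k, p) y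
      exact congrArg (fun k => φ k p y) (Nat.pair_unpair k)

end SelfSimilar

/-! The end space -/

section Ends

variable {X : Type*} [TopologicalSpace X]

/-- Makes membership testable on any given representative, by cofinality of equivalent sequences. -/
theorem toEnd_mem_endsIn {U : ExitingSequence X} {V : Set X} :
    U.toEnd ∈ endsIn V ↔ ∃ n, U.sets n ⊆ V := by
  refine ⟨?_, fun h => ⟨U, rfl, h⟩⟩
  rintro ⟨W, hW, n, hn⟩
  obtain ⟨m, -, hm⟩ := Quotient.exact hW n
  exact ⟨m, hm.trans hn⟩

theorem endsIn_mono {V W : Set X} (h : V ⊆ W) : endsIn V ⊆ endsIn W := by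
  rintro _ ⟨U, rfl, n, hn⟩
  exact ⟨U, rfl, n, hn.trans h⟩

theorem endsIn_inter (V W : Set X) : endsIn (V ∩ W) = endsIn V ∩ endsIn W := by
  refine (subset_inter (endsIn_mono inter_subset_left) (endsIn_mono inter_subset_right)).antisymm ?_
  rintro _ ⟨⟨U, rfl, n, hn⟩, h⟩
  obtain ⟨m, hm⟩ := toEnd_mem_endsIn.1 h
  exact ⟨U, rfl, max n m, subset_inter ((U.anti (le_max_left n m)).trans hn)
    ((U.anti (le_max_right n m)).trans hm)⟩

theorem endsIn_empty : endsIn (∅ : Set X) = ∅ := by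
  refine eq_empty_of_forall_notMem ?_
  rintro _ ⟨U, rfl, n, hn⟩
  exact (U.isConnected_sets n).nonempty.not_subset_empty hn

theorem endsIn_univ : endsIn (univ : Set X) = univ := by
  refine eq_univ_of_forall fun e => ?_
  induction e using Quotient.inductionOn with
  | h U => exact ⟨U, rfl, 0, subset_univ _⟩

theorem isTopologicalBasis_endsIn : TopologicalSpace.IsTopologicalBasis
    {W : Set (EndSpace X) | ∃ V : Set X, IsOpen V ∧ IsCompact (frontier V) ∧ W = endsIn V} where
  exists_subset_inter := by
    rintro _ ⟨V, hV, hVc, rfl⟩ _ ⟨W, hW, hWc, rfl⟩ e he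
    refine ⟨_, ⟨V ∩ W, hV.inter hW, ?_, rfl⟩, by rwa [endsIn_inter], by rw [endsIn_inter]⟩
    refine (hVc.union hWc).of_isClosed_subset isClosed_frontier ?_
    exact (frontier_inter_subset V W).trans
      (union_subset_union inter_subset_left inter_subset_right)
  sUnion_eq := eq_univ_of_univ_subset <| by
    rw [← endsIn_univ]
    exact subset_sUnion_of_mem ⟨univ, isOpen_univ, by simp, rfl⟩
  eq_generateFrom := rfl

theorem isOpen_endsIn {V : Set X} (hV : IsOpen V) (hVc : IsCompact (frontier V)) :
    IsOpen (endsIn V) :=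
  isTopologicalBasis_endsIn.isOpen ⟨V, hV, hVc, rfl⟩

/-- A preconnected set that misses the frontier of an open set lies on one side of it. -/
theorem IsPreconnected.subset_or_subset_compl_closure {C V : Set X} (hC : IsPreconnected C)
    (hV : IsOpen V) (h : C ∩ frontier V = ∅) : C ⊆ V ∨ C ⊆ (closure V)ᶜ := by
  refine hC.subset_or_subset hV isClosed_closure.isOpen_compl
    (disjoint_compl_right_iff_subset.2 subset_closure) fun x hx => ?_
  by_cases hxV : x ∈ V
  · exact .inl hxV
  · refine .inr fun hxc => ?_
    have : x ∈ C ∩ frontier V := ⟨hx, hxc, by rwa [hV.interior_eq]⟩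
    rwa [h] at this

theorem frontier_compl_closure_subset (V : Set X) : frontier (closure V)ᶜ ⊆ frontier V := by
  rw [frontier_compl]
  exact frontier_closure_subset

/-- An exiting sequence leaves the compact frontier, after which its connected terms lie on one side
of it. -/
theorem endsIn_compl {V : Set X} (hV : IsOpen V) (hVc : IsCompact (frontier V)) :
    (endsIn V)ᶜ = endsIn (closure V)ᶜ := by
  ext e
  induction e using Quotient.inductionOn with
  | h U =>
    change ¬ U.toEnd ∈ endsIn V ↔ U.toEnd ∈ endsIn (closure V)ᶜ
    constructor
    · intro h
      obtain ⟨n, hn⟩ := U.exits _ hVc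
      exact ⟨U, rfl, n, ((U.isConnected_sets n).isPreconnected.subset_or_subset_compl_closure hV
        hn).resolve_left fun h' => h ⟨U, rfl, n, h'⟩⟩
    · intro h h'
      have : U.toEnd ∈ endsIn (V ∩ (closure V)ᶜ) := by
        rw [endsIn_inter]
        exact ⟨h', h⟩
      rw [(disjoint_compl_right_iff_subset.2 subset_closure).inter_eq, endsIn_empty] at this
      exact this

theorem isClopen_endsIn {V : Set X} (hV : IsOpen V) (hVc : IsCompact (frontier V)) :
    IsClopen (endsIn V) := by
  refine ⟨⟨?_⟩, isOpen_endsIn hV hVc⟩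
  rw [endsIn_compl hV hVc]
  exact isOpen_endsIn isClosed_closure.isOpen_compl
    (hVc.of_isClosed_subset isClosed_frontier (frontier_compl_closure_subset V))

/-- The terms themselves serve as separating sets: if none separates the ends, each sequence
eventually enters every term of the other, which is equivalence. -/
theorem ExitingSequence.exists_mem_notMem_endsIn {U V : ExitingSequence X}
    (h : U.toEnd ≠ V.toEnd) :
    ∃ W : Set X, IsOpen W ∧ IsCompact (frontier W) ∧
      (U.toEnd ∈ endsIn W ∧ V.toEnd ∉ endsIn W ∨ V.toEnd ∈ endsIn W ∧ U.toEnd ∉ endsIn W) := by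
  by_contra! hc
  refine h (Quotient.sound fun n => ?_)
  obtain ⟨a, ha⟩ := toEnd_mem_endsIn.1 <| (hc _ (V.isOpen_sets n) (V.isCompact_frontier n)).2
    ⟨V, rfl, n, subset_rfl⟩
  obtain ⟨b, hb⟩ := toEnd_mem_endsIn.1 <| (hc _ (U.isOpen_sets n) (U.isCompact_frontier n)).1
    ⟨U, rfl, n, subset_rfl⟩
  exact ⟨max a b, (U.anti (le_max_left a b)).trans ha, (V.anti (le_max_right a b)).trans hb⟩

instance : TotallySeparatedSpace (EndSpace X) := by
  refine totallySeparatedSpace_iff_exists_isClopen.2 fun e f hef => ?_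
  induction e using Quotient.inductionOn with
  | h U =>
  induction f using Quotient.inductionOn with
  | h V =>
    obtain ⟨W, hW, hWc, h | h⟩ := ExitingSequence.exists_mem_notMem_endsIn (U := U) (V := V) hef
    · exact ⟨_, isClopen_endsIn hW hWc, h.1, h.2⟩
    · exact ⟨_, (isClopen_endsIn hW hWc).compl, h.2, not_not.2 h.1⟩

/-- A frontier point outside `K` would have its own component as an open neighbourhood; that
component meets the given one, hence equals it. -/
theorem frontier_connectedComponentIn_compl_subset [LocallyConnectedSpace X] {K : Set X}
    (hK : IsClosed K) (x : X) : frontier (connectedComponentIn Kᶜ x) ⊆ K := by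
  intro y hy
  by_contra hyK
  have ho : IsOpen (connectedComponentIn Kᶜ x) := hK.isOpen_compl.connectedComponentIn
  rw [ho.frontier_eq] at hy
  have hy' := hK.isOpen_compl.connectedComponentIn.mem_nhds (mem_connectedComponentIn hyK)
  obtain ⟨z, hzy, hzx⟩ := mem_closure_iff_nhds.1 hy.1 _ hy'
  refine hy.2 ?_
  rw [connectedComponentIn_eq hzx, ← connectedComponentIn_eq hzy]
  exact mem_connectedComponentIn hyK

/-- The ends lying in the components of the complements of an exhaustion form a basis. -/
theorem exists_component_subset (K : CompactExhaustion X) {V : Set X} (hV : IsOpen V)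
    (hVc : IsCompact (frontier V))
    {e : EndSpace X} (he : e ∈ endsIn V) :
    ∃ n x, e ∈ endsIn (connectedComponentIn (K n)ᶜ x) ∧ connectedComponentIn (K n)ᶜ x ⊆ V := by
  obtain ⟨U, rfl, n, hn⟩ := he
  obtain ⟨m, hm⟩ := K.exists_superset_of_isCompact hVc
  obtain ⟨k, hk⟩ := U.exits _ (K.isCompact m)
  set l := max n k with hl
  obtain ⟨x, hx⟩ := (U.isConnected_sets l).nonempty
  have hUK : U.sets l ⊆ (K m)ᶜ := fun y hy hyK =>
    (hk ▸ ⟨U.anti (le_max_right n k) hy, hyK⟩ : y ∈ (∅ : Set X))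
  have hUC := (U.isConnected_sets l).isPreconnected.subset_connectedComponentIn hx hUK
  refine ⟨m, x, ⟨U, rfl, l, hUC⟩, ?_⟩
  refine (isPreconnected_connectedComponentIn.subset_or_subset_compl_closure hV ?_).resolve_right
    fun h => h (hUC hx) (subset_closure (hn (U.anti (le_max_left n k) hx)))
  refine eq_empty_of_forall_notMem fun y hy => ?_
  exact connectedComponentIn_subset _ _ hy.1 (hm hy.2)

theorem isOpen_endsIn_component [LocallyConnectedSpace X] [T2Space X]
    (K : CompactExhaustion X) (n : ℕ) (x : X) :
    IsOpen (endsIn (connectedComponentIn (K n)ᶜ x)) :=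
  isOpen_endsIn (K.isCompact n).isClosed.isOpen_compl.connectedComponentIn
    ((K.isCompact n).of_isClosed_subset isClosed_frontier
      (frontier_connectedComponentIn_compl_subset (K.isCompact n).isClosed x))

theorem pairwiseDisjoint_components (G : Set X) :
    (range (connectedComponentIn G)).PairwiseDisjoint id := by
  rintro _ ⟨x, rfl⟩ _ ⟨y, rfl⟩ hne
  refine Set.disjoint_left.2 fun z hx hy => hne ?_
  rw [connectedComponentIn_eq hx, connectedComponentIn_eq hy]

theorem secondCountableTopology_endSpace [LocallyConnectedSpace X] [T2Space X]
    (K : CompactExhaustion X) [SecondCountableTopology X] :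
    SecondCountableTopology (EndSpace X) := by
  have hb : TopologicalSpace.IsTopologicalBasis
      (⋃ n, endsIn '' (range (connectedComponentIn (K n)ᶜ))) := by
    refine TopologicalSpace.isTopologicalBasis_of_isOpen_of_nhds ?_ ?_
    · simp only [mem_iUnion]
      rintro _ ⟨n, _, ⟨x, rfl⟩, rfl⟩
      exact isOpen_endsIn_component K n x
    · intro e W he hW
      obtain ⟨_, ⟨V, hV, hVc, rfl⟩, heV, hVW⟩ :=
        isTopologicalBasis_endsIn.exists_subset_of_mem_open he hW
      obtain ⟨n, x, hex, hxV⟩ := exists_component_subset K hV hVc heV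
      exact ⟨_, mem_iUnion.2 ⟨n, _, ⟨x, rfl⟩, rfl⟩, hex, (endsIn_mono hxV).trans hVW⟩
  refine hb.secondCountableTopology (countable_iUnion fun n => Countable.image ?_ _)
  -- `connectedComponentIn` is empty at points of `K n`, while countability of a disjoint open
  -- family needs nonempty members.
  have hne : (range (connectedComponentIn (K n)ᶜ) \ {∅}).Countable := by
    refine ((pairwiseDisjoint_components (K n)ᶜ).subset sdiff_subset).countable_of_isOpen ?_ ?_
    · rintro _ ⟨⟨x, rfl⟩, -⟩
      exact (K.isCompact n).isClosed.isOpen_compl.connectedComponentIn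
    · rintro C ⟨-, hC⟩
      exact nonempty_iff_ne_empty.2 hC
  exact (hne.union (countable_singleton ∅)).mono fun C hC =>
    (em (C = ∅)).elim .inr fun h => .inl ⟨hC, h⟩

/-- Finitely many components of the complement of `K n` contain all the ends. -/
theorem exists_finite_components [LocallyConnectedSpace X] [T2Space X] [ConnectedSpace X]
    (K : CompactExhaustion X) (n : ℕ) :
    ∃ T : Set (Set X), T.Finite ∧ T ⊆ range (connectedComponentIn (K n)ᶜ) ∧
      ∀ e : EndSpace X, ∃ C ∈ T, e ∈ endsIn C := by
  have hcl := (K.isCompact n).isClosed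
  have hK := K.subset_interior_succ n
  set L := interior (K (n + 1)) with hL
  have hfr : IsCompact (frontier L) := (K.isCompact (n + 1)).of_isClosed_subset isClosed_frontier
    (frontier_interior_subset.trans (K.isCompact (n + 1)).isClosed.frontier_subset)
  obtain ⟨t, ht⟩ := hfr.elim_finite_subcover (fun x => connectedComponentIn (K n)ᶜ x)
    (fun x => hcl.isOpen_compl.connectedComponentIn) fun x hx => mem_iUnion.2 ⟨x,
      mem_connectedComponentIn fun hxK =>
        ((isOpen_interior (s := K (n + 1))).frontier_eq ▸ hx).2 (hK hxK)⟩
  -- Components meeting the compact `frontier L` are finitely many. One that contains ends but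
  -- misses `frontier L` stays off `L`, while its own frontier lies in `K n ⊆ L`; it is therefore
  -- clopen, hence `univ` by connectedness.
  refine ⟨range (connectedComponentIn (K n)ᶜ) ∩
    (connectedComponentIn (K n)ᶜ '' t ∪ {univ}), ?_, inter_subset_left, fun e => ?_⟩
  · exact ((t.finite_toSet.image _).union (finite_singleton _)).subset inter_subset_right
  have he : e ∈ endsIn (K (n + 1))ᶜ := by
    induction e using Quotient.inductionOn with
    | h U =>
      obtain ⟨k, hk⟩ := U.exits _ (K.isCompact (n + 1))
      exact ⟨U, rfl, k, fun y hy hyK => (hk ▸ ⟨hy, hyK⟩ : y ∈ (∅ : Set X))⟩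
  obtain ⟨U, rfl, k, hk⟩ := he
  obtain ⟨x, hx⟩ := (U.isConnected_sets k).nonempty
  have hUC := (U.isConnected_sets k).isPreconnected.subset_connectedComponentIn hx
    (hk.trans (compl_subset_compl.2 (K.subset_succ n)))
  refine ⟨_, ⟨⟨x, rfl⟩, ?_⟩, U, rfl, k, hUC⟩
  by_cases h : connectedComponentIn (K n)ᶜ x ∩ frontier L = ∅
  · right
    have hCL := (isPreconnected_connectedComponentIn.subset_or_subset_compl_closure
      isOpen_interior h).resolve_left fun h' => hk hx (interior_subset (h' (hUC hx)))
    have hd : Disjoint (closure (connectedComponentIn (K n)ᶜ x)) L :=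
      (disjoint_left.2 fun y hy hyL => hCL hy (subset_closure hyL)).closure_left isOpen_interior
    refine (frontier_eq_empty_iff.1 ?_).resolve_left (nonempty_iff_ne_empty.1 ⟨x, hUC hx⟩)
    exact eq_empty_of_forall_notMem fun y hy => hd.le_bot ⟨frontier_subset_closure hy,
      hK (frontier_connectedComponentIn_compl_subset hcl x hy)⟩
  · left
    obtain ⟨y, hy, hyL⟩ := nonempty_iff_ne_empty.2 h
    obtain ⟨z, hz, hyz⟩ := mem_iUnion₂.1 (ht hyL)
    exact ⟨z, hz, by rw [connectedComponentIn_eq hyz, connectedComponentIn_eq hy]⟩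

theorem compactSpace_endSpace [LocallyConnectedSpace X] [T2Space X] [ConnectedSpace X]
    (K : CompactExhaustion X) : CompactSpace (EndSpace X) := by
  refine ⟨isCompact_iff_ultrafilter_le_nhds.2 fun 𝓤 _ => ?_⟩
  -- Since finitely many components carry all ends, the ultrafilter selects one at each level; the
  -- selected components are nested and form an exiting sequence whose end is the limit.
  have hx : ∀ n, ∃ x, endsIn (connectedComponentIn (K n)ᶜ x) ∈ 𝓤 := by
    intro n
    obtain ⟨T, hT, hTr, hTe⟩ := exists_finite_components K n
    have hU : ⋃₀ (endsIn '' T) ∈ 𝓤 := by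
      refine Filter.mem_of_superset Filter.univ_mem fun e _ => ?_
      obtain ⟨C, hC, he⟩ := hTe e
      exact ⟨_, ⟨C, hC, rfl⟩, he⟩
    obtain ⟨_, ⟨C, hC, rfl⟩, h⟩ := (Ultrafilter.finite_sUnion_mem_iff (hT.image _)).1 hU
    obtain ⟨x, rfl⟩ := hTr hC
    exact ⟨x, h⟩
  choose x hx using hx
  have hne : ∀ n, (connectedComponentIn (K n)ᶜ (x n)).Nonempty := fun n => by
    obtain ⟨_, U, rfl, k, hk⟩ := 𝓤.nonempty_of_mem (hx n)
    exact (U.isConnected_sets k).nonempty.mono hk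
  let U : ExitingSequence X :=
    { sets := fun n => connectedComponentIn (K n)ᶜ (x n)
      isOpen_sets := fun n => (K.isCompact n).isClosed.isOpen_compl.connectedComponentIn
      isConnected_sets := fun n => ⟨hne n, isPreconnected_connectedComponentIn⟩
      isCompact_frontier := fun n => (K.isCompact n).of_isClosed_subset isClosed_frontier
        (frontier_connectedComponentIn_compl_subset (K.isCompact n).isClosed _)
      subset_succ := fun n => by
        -- Both sets of ends belong to `𝓤`, so some end lies in both components and these meet.
        have := Filter.inter_mem (hx n) (hx (n + 1))
        rw [← endsIn_inter] at this
        obtain ⟨_, U, rfl, k, hk⟩ := 𝓤.nonempty_of_mem this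
        obtain ⟨z, hz⟩ := (U.isConnected_sets k).nonempty
        rw [connectedComponentIn_eq (hk hz).1]
        exact isPreconnected_connectedComponentIn.subset_connectedComponentIn (hk hz).2
          ((connectedComponentIn_subset _ _).trans (compl_subset_compl.2 (K.subset_succ n)))
      exits := fun L hL => by
        obtain ⟨n, hn⟩ := K.exists_superset_of_isCompact hL
        exact ⟨n, eq_empty_of_forall_notMem fun y hy =>
          connectedComponentIn_subset _ _ hy.1 (hn hy.2)⟩ }
  refine ⟨U.toEnd, mem_univ _, fun W hW => ?_⟩
  obtain ⟨_, ⟨V, hV, hVc, rfl⟩, hUV, hVW⟩ := isTopologicalBasis_endsIn.mem_nhds_iff.1 hW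
  obtain ⟨n, hn⟩ := toEnd_mem_endsIn.1 hUV
  exact Filter.mem_of_superset (hx n) ((endsIn_mono hn).trans hVW)

end Ends

/-! Surfaces -/

section Surface

variable {S : Type*} [TopologicalSpace S]

/-- The half-plane is convex, hence locally path connected, and the set is open in it. -/
theorem locallyConnectedSpace_openHalfPlane {O : Set (ℝ × ℝ)} (hO : IsOpen O) :
    LocallyConnectedSpace ↥(O ∩ {v : ℝ × ℝ | 0 ≤ v.2}) := by
  have hc : Convex ℝ {v : ℝ × ℝ | 0 ≤ v.2} :=
    (convex_Ici (0 : ℝ)).linear_preimage (LinearMap.snd ℝ ℝ ℝ)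
  have := hc.locallyPathConnectedSpace
  have he : IsOpenEmbedding
      (inclusion (inter_subset_right (s := O) (t := {v : ℝ × ℝ | 0 ≤ v.2}))) := by
    refine ⟨IsEmbedding.inclusion _, ?_⟩
    rw [range_inclusion]
    convert hO.preimage (continuous_subtype_val (p := (· ∈ {v : ℝ × ℝ | 0 ≤ v.2}))) using 1
    ext v
    exact and_iff_left v.2
  exact he.locallyConnectedSpace

theorem locallyCompactSpace_openHalfPlane {O : Set (ℝ × ℝ)} (hO : IsOpen O) :
    LocallyCompactSpace ↥(O ∩ {v : ℝ × ℝ | 0 ≤ v.2}) :=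
  (hO.isLocallyClosed.inter
    (isClosed_le continuous_const continuous_snd).isLocallyClosed).locallyCompactSpace

theorem IsTopologicalSurface.locallyConnectedSpace (hS : IsTopologicalSurface S) :
    LocallyConnectedSpace S := by
  refine locallyConnectedSpace_iff_subsets_isOpen_isConnected.2 fun p W hW => ?_
  obtain ⟨U, hU, hp, O, hO, ⟨f⟩⟩ := hS.locally_half_plane p
  have := locallyConnectedSpace_openHalfPlane hO
  have : LocallyConnectedSpace U := f.isOpenEmbedding.locallyConnectedSpace
  obtain ⟨V, hVW, hV, hpV, hVc⟩ := locallyConnectedSpace_iff_subsets_isOpen_isConnected.1 this ⟨p, hp⟩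
    (Subtype.val ⁻¹' W) (continuous_subtype_val.continuousAt.preimage_mem_nhds hW)
  exact ⟨Subtype.val '' V, image_subset_iff.2 hVW, hU.isOpenEmbedding_subtypeVal.isOpenMap _ hV,
    ⟨_, hpV, rfl⟩, hVc.image _ continuous_subtype_val.continuousOn⟩

theorem IsTopologicalSurface.locallyCompactSpace (hS : IsTopologicalSurface S) :
    LocallyCompactSpace S := by
  have := hS.hausdorff
  have : WeaklyLocallyCompactSpace S := ⟨fun p => by
    obtain ⟨U, hU, hp, O, hO, ⟨f⟩⟩ := hS.locally_half_plane p
    have := locallyCompactSpace_openHalfPlane hO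
    have : LocallyCompactSpace U := f.isClosedEmbedding.locallyCompactSpace
    obtain ⟨C, hC, hpC⟩ := exists_compact_mem_nhds (⟨p, hp⟩ : U)
    exact ⟨Subtype.val '' C, hC.image continuous_subtype_val,
      hU.isOpenEmbedding_subtypeVal.isOpenMap.image_mem_nhds hpC⟩⟩
  infer_instance

end Surface

theorem mainTheorem8 {S : Type*} [TopologicalSpace S] (hS : IsTopologicalSurface S)
    (hor : IsOrientableSurface S) :
    IsSelfSimilar (EndSpace S) (nonplanarEnds S) ↔
      HasRadialSymmetry (EndSpace S) (nonplanarEnds S) := by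
  have := hS.connected
  have := hS.secondCountable
  have := hS.hausdorff
  have := hS.locallyConnectedSpace
  have := hS.locallyCompactSpace
  have K : CompactExhaustion S := default
  have := compactSpace_endSpace K
  have := secondCountableTopology_endSpace K
  exact ⟨IsSelfSimilar.hasRadialSymmetry, HasRadialSymmetry.isSelfSimilar⟩
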